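/- Let $\mathcal C$ be a triangulated category. A \emph{weight structure} $w$ on $\mathcal C$ is given by a pair of classes of objects $(\mathrm{LO},\mathrm{RO})$ such that $\mathrm{RO}=\{Y:\mathcal C(X,Y)=0\ \forall X\in \mathrm{LO}\}$, $\mathrm{LO}=\{X:\mathcal C(X,Y)=0\ \forall Y\in \mathrm{RO}\}$, every object $M$ fits into a distinguished triangle $L\to M\to R\to L[1]$ with $L\in\mathrm{LO}$, $R\in\mathrm{RO}$, and $\mathrm{LO}\subset\mathrm{LO}[1]$. Put $\mathcal C_{w\le k}=\mathrm{LO}[k]$ and $\mathcal C_{w\ge k}=\mathrm{RO}[k-1]$ for $k\in\mathbb Z$. A \emph{$k$-weight decomposition} of $X$ is a distinguished triangle $w_{\le k}X\to X\to w_{\ge k+1}X\to (w_{\le k}X)[1]$ with $w_{\le k}X\in\mathcal C_{w\le k}$ and $w_{\ge k+1}X\in\mathcal C_{w\ge k+1}$ (it exists but is not canonical; $w_{\le k}X$ and $w_{\ge k+1}X$ always denote choices coming from such a triangle, together with the corresponding morphisms). For $k<l$ and any choices of $w_{\le k}X$, $w_{\le l}X$ there is a unique \emph{connecting morphism} $w_{\le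 k}X\to w_{\le l}X$ compatible with the morphisms to $X$. Let $m\le n$ be integers. An object $M$ of $\mathcal C$ is \emph{without weights $m,\dots,n$} if there are choices of $w_{\le n}M$ and $w_{\le m-1}M$ such that $w_{\le n}M\to M$ factors through $w_{\le m-1}M\to M$. A cohomological functor $H$ from $\mathcal C$ to an abelian category (that is, a contravariant functor converting distinguished triangles into long exact sequences) is \emph{of weight range $[m,n]$} if it annihilates $\mathcal C_{w\le m-1}$ and $\mathcal C_{w\ge n+1}$. For a contravariant functor $H$ from $\mathcal C$ to an abelian category, the \emph{virtual $t$-truncation} $\tau_{\le n}(H)$ is given by $\tau_{\le n}(H)(M)=\operatorname{Im}(H(w_{\le n+1}M)\to H(w_{\le n}M))$, the image of $H$ of the connecting morphism, for an arbitrary choice of $w_{\le n}M$, $w_{\le n+1}M$. Write $H_I=\mathcal C(-,I)$. An object $X$ is an \emph{extension of $B$ by $A$} if there is a distinguished triangle $A\to X\to B\to A[1]$. \textbf{I.} For every object $M$ of $\mathcal C$ the following conditions are equivalent. \begin{enumerate} \item $M$ is without weights $m,\dots,n$. \item $M$ is a retract of some object $\widetilde M$ that is an extension of an element of $\mathcal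 C_{w\ge n+1}$ by an element of $\mathcal C_{w\le m-1}$. \item $H(M)=0$ for every cohomological functor $H$ of weight range $[m,n]$ with values in any abelian category. \item $\tau_{\le n}(H_I)(M)=0$ for all $I\in\mathcal C_{w\ge m}$ (equivalently for all, or for some, choices of the truncations of $M$ used to compute it). \item $\tau_{\le n}(H_{I_0})(M)=0$, where $I_0$ is a choice of $w_{\ge m}M$ (equivalently for all, or for some, choices of $I_0$ and of the truncations of $M$). \end{enumerate} \textbf{II.} If moreover $\mathcal C$ is idempotent complete (all idempotent endomorphisms split), then these conditions are also equivalent to each of the following. \begin{enumerate} \item $M$ itself is an extension of an element of $\mathcal C_{w\ge n+1}$ by an element of $\mathcal C_{w\le m-1}$. \item There exist choices of $w_{\le m-1}M$ and $w_{\le n}M$ that are isomorphic objects. \item There exist choices of $w_{\le m-1}M$ and $w_{\le n}M$ such that the connecting morphism $w_{\le m-1}M\to w_{\le n}M$ is an isomorphism. \end{enumerate} -/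

import Mathlib

open CategoryTheory CategoryTheory.Limits CategoryTheory.Pretriangulated Opposite
open scoped CategoryTheory.Pretriangulated.Opposite

universe u v uA vA

section

variable (C : Type u) [Category.{v} C] [Preadditive C] [HasZeroObject C] [HasShift C ℤ]
  [∀ k : ℤ, (shiftFunctor C k).Additive] [Pretriangulated C]

/-- A torsion theory `(LO, RO)`: `LO^⊥ = RO`, `LO = ^⊥RO`, and every object `M` has a
decomposition triangle `L ⟶ M ⟶ R ⟶ L⟦1⟧` with `L ∈ LO` and `R ∈ RO`. -/
structure TorsionTheory where
  lo : ObjectProperty C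
  ro : ObjectProperty C
  rightOrthogonal_lo : lo.rightOrthogonal = ro
  leftOrthogonal_ro : ro.leftOrthogonal = lo
  exists_triangle (M : C) : ∃ (L R : C) (_ : lo L) (_ : ro R) (a : L ⟶ M) (b : M ⟶ R)
    (d : R ⟶ L⟦(1 : ℤ)⟧), Triangle.mk a b d ∈ distTriang C

/-- A weight structure: a torsion theory with `LO ⊆ LO[1]`.
For a class `P` of objects closed under isomorphisms, `P[k]` is `P.shift (-k)`, that is,
`X ∈ P[k]` if and only if `X⟦-k⟧ ∈ P`. -/
structure WeightStructure extends TorsionTheory C where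
  weighted : lo ≤ lo.shift (-1 : ℤ)

end

section

variable {C : Type u} [Category.{v} C] [Preadditive C] [HasZeroObject C] [HasShift C ℤ]
  [∀ k : ℤ, (shiftFunctor C k).Additive] [Pretriangulated C]

/-- `X` is an extension of `B` by `A`: there is a distinguished triangle
`A ⟶ X ⟶ B ⟶ A⟦1⟧`. -/
def IsExtensionOf (X B A : C) : Prop :=
  ∃ (f : A ⟶ X) (g : X ⟶ B) (h : B ⟶ A⟦(1 : ℤ)⟧), Triangle.mk f g h ∈ distTriang C

namespace WeightStructure

/-- `C_{w ≤ k} = LO[k]`. -/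
def le (w : WeightStructure C) (k : ℤ) : ObjectProperty C := w.lo.shift (-k)

/-- `C_{w ≥ k} = (RO[-1])[k]`. -/
def ge (w : WeightStructure C) (k : ℤ) : ObjectProperty C :=
  (w.ro.shift (1 : ℤ)).shift (-k)

/-- A `k`-weight decomposition of `X`: a distinguished triangle
`w_{≤k} X ⟶ X ⟶ w_{≥k+1} X ⟶ (w_{≤k} X)⟦1⟧`, that is, a choice of `w_{≤k} X` and
`w_{≥k+1} X` together with the morphisms relating them to `X`. -/
structure Decomposition (w : WeightStructure C) (k : ℤ) (X : C) where
  left : C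
  right : C
  ι : left ⟶ X
  π : X ⟶ right
  δ : right ⟶ left⟦(1 : ℤ)⟧
  distinguished : Triangle.mk ι π δ ∈ distTriang C
  left_le : w.le k left
  right_ge : w.ge (k + 1) right

/-- Choices of `w_{≤k} X` and `w_{≤l} X` (for `k < l`), together with the connecting morphism
`w_{≤k} X ⟶ w_{≤l} X` over `X`. -/
structure TruncationPair (w : WeightStructure C) (k l : ℤ) (X : C) where
  lower : w.Decomposition k X
  upper : w.Decomposition l X
  conn : lower.left ⟶ upper.left
  conn_ι : conn ≫ upper.ι = lower.ι

/-- `g` kills weights `m, …, n`: for some choice of `w_{≤n} M` and `w_{≤m-1} N`, the composition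
`w_{≤n} M ⟶ M ⟶ N` factors through `w_{≤m-1} N ⟶ N`. -/
def KillsWeights (w : WeightStructure C) (m n : ℤ) {M N : C} (g : M ⟶ N) : Prop :=
  ∃ (D : w.Decomposition n M) (E : w.Decomposition (m - 1) N) (h : D.left ⟶ E.left),
    h ≫ E.ι = D.ι ≫ g

/-- `M` is without weights `m, …, n`. -/
def IsWithoutWeights (w : WeightStructure C) (m n : ℤ) (M : C) : Prop :=
  w.KillsWeights m n (𝟙 M)

/-- The contravariant functor `H` is cohomological and of weight range `[m, n]`: it annihilates
`C_{w ≤ m-1}` and `C_{w ≥ n+1}`. -/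
structure IsOfWeightRange (w : WeightStructure C) (m n : ℤ) {A : Type uA} [Category.{vA} A]
    [Abelian A] (H : Cᵒᵖ ⥤ A) : Prop where
  cohomological : H.IsHomological
  isZero_of_le (X : C) (hX : w.le (m - 1) X) : IsZero (H.obj (op X))
  isZero_of_ge (X : C) (hX : w.ge (n + 1) X) : IsZero (H.obj (op X))

/-- The value at `X` of the virtual `t`-truncation `τ_{≤k}(H)`, namely
`Im (H(w_{≤k+1} X) ⟶ H(w_{≤k} X))`, computed by means of given choices of `w_{≤k} X` and
`w_{≤k+1} X`. -/
noncomputable def virtualTruncation {w : WeightStructure C} {k : ℤ} {X : C} {A : Type uA}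
    [Category.{vA} A] [Abelian A] (H : Cᵒᵖ ⥤ A) (T : w.TruncationPair k (k + 1) X) : A :=
  image (H.map T.conn.op)

end WeightStructure

end

/-!
An object `M` is without weights `m, …, n` if and only if `w_{≤n} M ⟶ M ⟶ w_{≥m} M` vanishes, and
then the cone of `w_{≥n+1} M ⟶ (w_{≤n} M)⟦1⟧ ⟶ (w_{≤m-1} M)⟦1⟧`, shifted by `-1`, is an extension
of which `M` is a retract.

To detect this by cohomological functors, one shows that the virtual `t`-truncation `τ_{≤n}(H)` of
a cohomological functor `H` is cohomological. It is a functor since the morphism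
`w_{≤n} X ⟶ w_{≤n+1} Y` over a morphism `X ⟶ Y` is unique, and it is half-exact since the cocone of
this morphism has weight `≤ n`. It annihilates `C_{w ≥ n+1}`, and also `C_{w ≤ m-1}` if `H` does.
For `H = C(-, w_{≥m} M)`, the vanishing of `τ_{≤n}(H)(M)` kills the composition
`w_{≤n} M ⟶ M ⟶ w_{≥m} M`.

If idempotents split, the composition `w_{≤m-1} M ⟶ w_{≤n} M ⟶ w_{≤m-1} M` is an idempotent, and
its image over `M` yields a triangle that is a retract of the `n`-weight decomposition of `M`.
-/

section ShiftOrthogonal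

variable {C : Type*} [Category* C] {G : Type*} [AddGroup G] [HasShift C G] (P : ObjectProperty C)
  [P.IsClosedUnderIsomorphisms]

lemma shift_neg_prop_shift (a : G) {X : C} (hX : P X) : P.shift (-a) (X⟦a⟧) :=
  P.prop_of_iso ((shiftFunctorCompIsoId C a (-a) (by simp)).symm.app X) hX

variable [HasZeroMorphisms C] [∀ a : G, (shiftFunctor C a).PreservesZeroMorphisms]

lemma rightOrthogonal_shift (a : G) :
    P.rightOrthogonal.shift a = (P.shift a).rightOrthogonal := by
  ext Y
  constructor
  · intro hY X f hX
    apply (shiftFunctor C a).map_injective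
    rw [hY (f⟦a⟧') hX, Functor.map_zero]
  · intro hY X f hX
    let e := (shiftFunctorCompIsoId C (-a) a (by simp)).app X
    obtain ⟨g, hg⟩ := (shiftFunctor C a).map_surjective (e.hom ≫ f)
    rw [← cancel_epi e.hom, ← hg, hY g (P.prop_of_iso e.symm hX), Functor.map_zero, comp_zero]

lemma leftOrthogonal_shift (a : G) :
    P.leftOrthogonal.shift a = (P.shift a).leftOrthogonal := by
  ext X
  constructor
  · intro hX Y f hY
    apply (shiftFunctor C a).map_injective
    rw [hX (f⟦a⟧') hY, Functor.map_zero]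
  · intro hX Y f hY
    let e := (shiftFunctorCompIsoId C (-a) a (by simp)).app Y
    obtain ⟨g, hg⟩ := (shiftFunctor C a).map_surjective (f ≫ e.inv)
    rw [← cancel_mono e.inv, ← hg, hX g (P.prop_of_iso e.symm hY), Functor.map_zero, zero_comp]

end ShiftOrthogonal

section RetractOrthogonal

variable {C : Type*} [Category* C] [HasZeroMorphisms C] (P : ObjectProperty C)

instance : P.rightOrthogonal.IsStableUnderRetracts where
  of_retract r hY X f hX := by
    rw [← Category.comp_id f, ← r.retract, ← Category.assoc, hY (f ≫ r.i) hX, zero_comp]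

instance : P.leftOrthogonal.IsStableUnderRetracts where
  of_retract r hX Y f hY := by
    rw [← Category.id_comp f, ← r.retract, Category.assoc, hX (r.r ≫ f) hY, comp_zero]

end RetractOrthogonal

lemma exists_abelian_equivalence_ulift (A : Type u) [Category.{v} A] [Abelian A] :
    ∃ (B : Type (max u uA)) (_ : Category.{max v vA} B) (_ : Abelian B), Nonempty (A ≌ B) := by
  let : Category.{v} (ULift.{uA} A) := uliftCategory A
  let e : A ≌ ULiftHom.{vA} (ULift.{uA} A) := ULift.equivalence.trans ULiftHom.equiv
  let := Preadditive.ofFullyFaithful e.fullyFaithfulInverse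
  have : HasFiniteProducts (ULiftHom.{vA} (ULift.{uA} A)) :=
    ⟨fun _ ↦ Adjunction.hasLimitsOfShape_of_equivalence e.inverse⟩
  exact ⟨ULiftHom.{vA} (ULift.{uA} A), inferInstance, abelianOfEquivalence e.inverse, ⟨e⟩⟩

section Pretriangulated

variable {C : Type*} [Category* C] [Preadditive C] [HasZeroObject C] [HasShift C ℤ]
  [∀ k : ℤ, (shiftFunctor C k).Additive] [Pretriangulated C]

lemma distinguished_of_iso₂ {A X Y B : C} {f : A ⟶ X} {g : X ⟶ B} {h : B ⟶ A⟦(1 : ℤ)⟧}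
    (hT : Triangle.mk f g h ∈ distTriang C) (e : X ≅ Y) :
    Triangle.mk (f ≫ e.hom) (e.inv ≫ g) h ∈ distTriang C :=
  isomorphic_distinguished _ hT _
    (Triangle.isoMk _ _ (Iso.refl A) e.symm (Iso.refl B)
      (show (f ≫ e.hom) ≫ e.inv = 𝟙 A ≫ f by simp)
      (show (e.inv ≫ g) ≫ 𝟙 B = e.inv ≫ g by simp)
      (show h ≫ (𝟙 A)⟦(1 : ℤ)⟧' = 𝟙 B ≫ h by simp))

lemma nonempty_retract_obj₃ {T T' : Triangle C} (hT : T ∈ distTriang C) (hT' : T' ∈ distTriang C)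
    (r : RetractArrow T.mor₁ T'.mor₁) : Nonempty (Retract T.obj₃ T'.obj₃) := by
  obtain ⟨i₃, hi₂, hi₃⟩ := complete_distinguished_triangle_morphism T T' hT hT'
    r.i.left r.i.right r.i_w.symm
  obtain ⟨r₃, hr₂, hr₃⟩ := complete_distinguished_triangle_morphism T' T hT' hT
    r.r.left r.r.right r.r_w.symm
  let i : T ⟶ T' := ⟨r.i.left, r.i.right, i₃, r.i_w.symm, hi₂, hi₃⟩
  let p : T' ⟶ T := ⟨r.r.left, r.r.right, r₃, r.r_w.symm, hr₂, hr₃⟩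
  -- The completions `i₃` and `r₃` are not canonical, so `i₃ ≫ r₃` need not be the identity.
  have : IsIso (i₃ ≫ r₃) := isIso₃_of_isIso₁₂ (i ≫ p) hT hT
    (by rw [show (i ≫ p).hom₁ = 𝟙 _ from r.retract_left]; infer_instance)
    (by rw [show (i ≫ p).hom₂ = 𝟙 _ from r.retract_right]; infer_instance)
  exact ⟨⟨i₃, r₃ ≫ inv (i₃ ≫ r₃), by rw [← Category.assoc, IsIso.hom_inv_id]⟩⟩

lemma exists_retract_isExtensionOf {A A' B M : C} {a : A ⟶ M} {b : M ⟶ B} {d : B ⟶ A⟦(1 : ℤ)⟧}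
    (hT : Triangle.mk a b d ∈ distTriang C) {h : A ⟶ A'} {e : A' ⟶ M} (hhe : h ≫ e = a) :
    ∃ M' : C, Nonempty (Retract M M') ∧ IsExtensionOf M' B A' := by
  obtain ⟨M', i, q, hT'⟩ := distinguished_cocone_triangle₂ (d ≫ h⟦(1 : ℤ)⟧')
  obtain ⟨α, hα₁, hα₂⟩ : ∃ α : M ⟶ M', a ≫ α = h ≫ i ∧ b ≫ 𝟙 B = α ≫ q :=
    complete_distinguished_triangle_morphism₂ _ _ hT hT' h (𝟙 B) (Category.id_comp _).symm
  have hda : d ≫ a⟦(1 : ℤ)⟧' = 0 := comp_distTriang_mor_zero₃₁ _ hT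
  obtain ⟨r, hr⟩ : ∃ r : M' ⟶ M, i ≫ r = e := by
    obtain ⟨r, hr, -⟩ := complete_distinguished_triangle_morphism₂ _ _ hT'
      (contractible_distinguished M) e 0 (by
        change (d ≫ h⟦(1 : ℤ)⟧') ≫ e⟦(1 : ℤ)⟧' = 0 ≫ 0
        rw [Category.assoc, ← Functor.map_comp, hhe, hda, zero_comp])
    exact ⟨r, hr.trans (Category.comp_id _)⟩
  rw [Category.comp_id] at hα₂
  -- `α ≫ r` is the identity only after composition with `a`; `r` is corrected accordingly.
  obtain ⟨g, hg⟩ : ∃ g : B ⟶ M, α ≫ r - 𝟙 M = b ≫ g :=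
    Triangle.yoneda_exact₂ _ hT (α ≫ r - 𝟙 M) (by
      change a ≫ (α ≫ r - 𝟙 M) = 0
      rw [Preadditive.comp_sub, ← Category.assoc, hα₁, Category.assoc, hr, hhe, Category.comp_id,
        sub_self])
  refine ⟨M', ⟨⟨α, r - q ≫ g, ?_⟩⟩, i, q, _, hT'⟩
  rw [Preadditive.comp_sub, ← Category.assoc, ← hα₂, ← hg, sub_sub_cancel]

lemma isHomological_comp {A B : Type*} [Category* A] [Category* B] [Abelian A] [Abelian B]
    (H : C ⥤ A) [H.IsHomological] (F : A ⥤ B) [F.PreservesZeroMorphisms] [F.PreservesHomology] :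
    (H ⋙ F).IsHomological where
  exact T hT := (H.map_distinguished_exact T hT).map F

end Pretriangulated

section

variable {C : Type u} [Category.{v} C] [Preadditive C] [HasZeroObject C] [HasShift C ℤ]
  [∀ k : ℤ, (shiftFunctor C k).Additive] [Pretriangulated C]

namespace WeightStructure

section

variable (w : WeightStructure C)

instance : w.lo.IsClosedUnderIsomorphisms := by
  rw [← w.leftOrthogonal_ro]; infer_instance

instance : w.ro.IsClosedUnderIsomorphisms := by
  rw [← w.rightOrthogonal_lo]; infer_instance

lemma ge_succ_eq_shift (k : ℤ) : w.ge (k + 1) = w.ro.shift (-k) :=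
  w.ro.shift_shift (-(k + 1)) 1 (-k) (by lia)

lemma rightOrthogonal_le (k : ℤ) : (w.le k).rightOrthogonal = w.ge (k + 1) := by
  rw [le, ← rightOrthogonal_shift, w.rightOrthogonal_lo, ge_succ_eq_shift]

lemma leftOrthogonal_ge_succ (k : ℤ) : (w.ge (k + 1)).leftOrthogonal = w.le k := by
  rw [ge_succ_eq_shift, ← leftOrthogonal_shift, w.leftOrthogonal_ro, le]

instance (k : ℤ) : (w.le k).IsStableUnderRetracts := by
  rw [← leftOrthogonal_ge_succ]; infer_instance

instance (k : ℤ) : (w.ge (k + 1)).IsStableUnderRetracts := by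
  rw [← rightOrthogonal_le]; infer_instance

instance (k : ℤ) : (w.le k).IsTriangulatedClosed₂ := by
  rw [← leftOrthogonal_ge_succ]; infer_instance

lemma exists_decomposition (k : ℤ) (X : C) : Nonempty (w.Decomposition k X) := by
  obtain ⟨L, R, hL, hR, a, b, d, hT⟩ := w.exists_triangle (X⟦-k⟧)
  exact ⟨{
    left := L⟦k⟧
    right := R⟦k⟧
    ι := _
    π := _
    δ := _
    distinguished := distinguished_of_iso₂ (Triangle.shift_distinguished _ hT k)
      ((shiftFunctorCompIsoId C (-k) k (by simp)).app X)
    left_le := shift_neg_prop_shift w.lo k hL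
    right_ge := by
      rw [ge_succ_eq_shift]
      exact shift_neg_prop_shift w.ro k hR }⟩

end

variable {w : WeightStructure C} {k l m n : ℤ} {X Y M : C}

lemma le_mono (hkl : k ≤ l) : w.le k ≤ w.le l := by
  induction l, hkl using Int.leInduction with
  | base => exact le_rfl
  | succ l _ ih =>
    intro X hX
    have h : (w.lo.shift (-1 : ℤ)).shift (-l) X := w.weighted _ (ih X hX)
    rwa [w.lo.shift_shift (-l) (-1) (-(l + 1)) (by lia)] at h

lemma zero_of_le_of_ge (hkl : k < l) (hX : w.le k X) (hY : w.ge l Y) (f : X ⟶ Y) : f = 0 := by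
  obtain ⟨l, rfl⟩ : ∃ j, l = j + 1 := ⟨l - 1, by simp⟩
  rw [← rightOrthogonal_le] at hY
  exact hY f (le_mono (by lia) X hX)

lemma ge_anti (hkl : k ≤ l) : w.ge l ≤ w.ge k := by
  intro Y hY
  obtain ⟨k, rfl⟩ : ∃ j, k = j + 1 := ⟨k - 1, by simp⟩
  rw [← rightOrthogonal_le]
  exact fun X f hX ↦ zero_of_le_of_ge (by lia) hX hY f

lemma le_shift_add (hX : w.le k X) (j : ℤ) : w.le (k + j) (X⟦j⟧) :=
  w.lo.prop_of_iso ((shiftFunctorAdd' C j (-(k + j)) (-k) (by lia)).app X) hX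

lemma le_obj₁_of_distinguished (T : Triangle C) (hT : T ∈ distTriang C)
    (h₂ : w.le k T.obj₂) (h₃ : w.le (k + 1) T.obj₃) : w.le k T.obj₁ :=
  (w.le k).ext_of_isTriangulatedClosed₂ _ (inv_rot_of_distTriang _ hT)
    (by simpa using le_shift_add h₃ (-1)) h₂

namespace Decomposition

lemma right_ge_pred (D : w.Decomposition (m - 1) M) : w.ge m D.right := by
  simpa using D.right_ge

lemma exists_comp_ι_eq (D : w.Decomposition k X) {L : C} (f : L ⟶ X) (hf : f ≫ D.π = 0) :
    ∃ g : L ⟶ D.left, g ≫ D.ι = f := by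
  obtain ⟨g, hg⟩ := Triangle.coyoneda_exact₂ _ D.distinguished f hf
  exact ⟨g, hg.symm⟩

lemma exists_comp_ι_eq_of_le (D : w.Decomposition k X) {L : C} (hL : w.le k L) (f : L ⟶ X) :
    ∃ g : L ⟶ D.left, g ≫ D.ι = f :=
  D.exists_comp_ι_eq f (zero_of_le_of_ge (by lia) hL D.right_ge _)

lemma eq_zero_of_comp_ι (D : w.Decomposition k X) {L : C} (hL : w.le l L) (hlk : l < k)
    {f : L ⟶ D.left} (hf : f ≫ D.ι = 0) : f = 0 := by
  apply (shiftFunctor C (1 : ℤ)).map_injective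
  obtain ⟨g, hg⟩ : ∃ g, f⟦(1 : ℤ)⟧' = g ≫ D.δ :=
    Triangle.coyoneda_exact₁ _ D.distinguished _ (by
      change f⟦1⟧' ≫ D.ι⟦1⟧' = 0
      rw [← Functor.map_comp, hf, Functor.map_zero])
  rw [hg, zero_of_le_of_ge (by lia) (le_shift_add hL 1) D.right_ge g, zero_comp, Functor.map_zero]

lemma eq_of_comp_ι (D : w.Decomposition k X) {L : C} (hL : w.le l L) (hlk : l < k)
    {f g : L ⟶ D.left} (hfg : f ≫ D.ι = g ≫ D.ι) : f = g :=
  sub_eq_zero.1 (D.eq_zero_of_comp_ι hL hlk (by rw [Preadditive.sub_comp, hfg, sub_self]))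

/-- A choice of a morphism `w_{≤k} X ⟶ w_{≤l} Y` lying over a given morphism `X ⟶ Y`, for `k ≤ l`.
It is unique for `k < l`. -/
noncomputable def lift (D : w.Decomposition k X) (E : w.Decomposition l Y) (hkl : k ≤ l)
    (φ : X ⟶ Y) : D.left ⟶ E.left :=
  (E.exists_comp_ι_eq_of_le (le_mono hkl _ D.left_le) (D.ι ≫ φ)).choose

lemma lift_ι (D : w.Decomposition k X) (E : w.Decomposition l Y) (hkl : k ≤ l) (φ : X ⟶ Y) :
    D.lift E hkl φ ≫ E.ι = D.ι ≫ φ :=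
  (E.exists_comp_ι_eq_of_le (le_mono hkl _ D.left_le) (D.ι ≫ φ)).choose_spec

end Decomposition

variable (w) in
lemma exists_truncationPair (hkl : k ≤ l) (X : C) : Nonempty (w.TruncationPair k l X) := by
  obtain ⟨D⟩ := w.exists_decomposition k X
  obtain ⟨E⟩ := w.exists_decomposition l X
  exact ⟨⟨D, E, D.lift E hkl (𝟙 X), by rw [D.lift_ι, Category.comp_id]⟩⟩

lemma KillsWeights.of_comp_eq_zero {N : C} {g : M ⟶ N} (D : w.Decomposition n M)
    (E : w.Decomposition (m - 1) N) (h : D.ι ≫ g ≫ E.π = 0) : w.KillsWeights m n g :=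
  ⟨D, E, E.exists_comp_ι_eq (D.ι ≫ g) (by rw [Category.assoc, h])⟩

lemma isWithoutWeights_of_le (hM : w.le (m - 1) M) : w.IsWithoutWeights m n M := by
  obtain ⟨D⟩ := w.exists_decomposition n M
  obtain ⟨E⟩ := w.exists_decomposition (m - 1) M
  refine .of_comp_eq_zero D E ?_
  rw [zero_of_le_of_ge (by lia) hM E.right_ge (𝟙 M ≫ E.π), comp_zero]

lemma isWithoutWeights_of_ge (hM : w.ge (n + 1) M) : w.IsWithoutWeights m n M := by
  obtain ⟨D⟩ := w.exists_decomposition n M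
  obtain ⟨E⟩ := w.exists_decomposition (m - 1) M
  refine .of_comp_eq_zero D E ?_
  rw [zero_of_le_of_ge (by lia) D.left_le hM D.ι, zero_comp]

lemma TruncationPair.comp_conn_eq (T : w.TruncationPair k l X) (hkl : k < l) {L : C}
    (hL : w.le k L) {a b : L ⟶ T.lower.left} (hab : a ≫ T.lower.ι = b ≫ T.lower.ι) :
    a ≫ T.conn = b ≫ T.conn :=
  T.upper.eq_of_comp_ι hL hkl (by rw [Category.assoc, Category.assoc, T.conn_ι, hab])

section VirtualTruncation

variable {A : Type uA} [Category.{vA} A] [Abelian A] (H : Cᵒᵖ ⥤ A)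

/-- The inclusion of `τ_{≤k}(H)(X) = Im (H(w_{≤k+1} X) ⟶ H(w_{≤k} X))` into `H(w_{≤k} X)`. -/
noncomputable def virtualTruncationι (T : w.TruncationPair k (k + 1) X) :
    virtualTruncation H T ⟶ H.obj (op T.lower.left) :=
  image.ι (H.map T.conn.op)

/-- The projection of `H(w_{≤k+1} X)` onto
`τ_{≤k}(H)(X) = Im (H(w_{≤k+1} X) ⟶ H(w_{≤k} X))`. -/
noncomputable def virtualTruncationπ (T : w.TruncationPair k (k + 1) X) :
    H.obj (op T.upper.left) ⟶ virtualTruncation H T :=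
  factorThruImage (H.map T.conn.op)

instance (T : w.TruncationPair k (k + 1) X) : Mono (virtualTruncationι H T) :=
  inferInstanceAs (Mono (image.ι (H.map T.conn.op)))

instance (T : w.TruncationPair k (k + 1) X) : Epi (virtualTruncationπ H T) :=
  inferInstanceAs (Epi (factorThruImage (H.map T.conn.op)))

lemma virtualTruncationπ_ι (T : w.TruncationPair k (k + 1) X) :
    virtualTruncationπ H T ≫ virtualTruncationι H T = H.map T.conn.op :=
  image.fac _

/-- The morphism between the values of the virtual `t`-truncation that is induced by a morphism
`X ⟶ Y`, for arbitrary choices of truncations of `X` and `Y`. -/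
noncomputable def virtualTruncationMap (T : w.TruncationPair k (k + 1) X)
    (T' : w.TruncationPair k (k + 1) Y) (φ : X ⟶ Y) :
    virtualTruncation H T' ⟶ virtualTruncation H T :=
  image.map (Arrow.homMk (f := Arrow.mk (H.map T'.conn.op)) (g := Arrow.mk (H.map T.conn.op))
    (H.map (T.upper.lift T'.upper le_rfl φ).op) (H.map (T.lower.lift T'.lower le_rfl φ).op) (by
      have h : T.lower.lift T'.lower le_rfl φ ≫ T'.conn =
          T.conn ≫ T.upper.lift T'.upper le_rfl φ :=
        T'.upper.eq_of_comp_ι T.lower.left_le (lt_add_one k) (by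
          simp only [Category.assoc, Decomposition.lift_ι, T'.conn_ι, reassoc_of% T.conn_ι])
      change H.map _ ≫ H.map _ = H.map _ ≫ H.map _
      rw [← H.map_comp, ← H.map_comp, ← op_comp, ← op_comp, h]))

lemma virtualTruncationMap_ι (T : w.TruncationPair k (k + 1) X)
    (T' : w.TruncationPair k (k + 1) Y) {φ : X ⟶ Y} {a : T.lower.left ⟶ T'.lower.left}
    (ha : a ≫ T'.lower.ι = T.lower.ι ≫ φ) :
    virtualTruncationMap H T T' φ ≫ virtualTruncationι H T =
      virtualTruncationι H T' ≫ H.map a.op := by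
  have ha' : T.lower.lift T'.lower le_rfl φ ≫ T'.conn = a ≫ T'.conn :=
    T'.comp_conn_eq (lt_add_one k) T.lower.left_le (by rw [Decomposition.lift_ι, ha])
  calc virtualTruncationMap H T T' φ ≫ virtualTruncationι H T
    _ = virtualTruncationι H T' ≫ H.map (T.lower.lift T'.lower le_rfl φ).op := image.map_ι _
    _ = virtualTruncationι H T' ≫ H.map a.op := by
      rw [← cancel_epi (virtualTruncationπ H T'), ← Category.assoc, ← Category.assoc,
        virtualTruncationπ_ι, ← H.map_comp, ← H.map_comp, ← op_comp, ← op_comp, ha']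

lemma virtualTruncationπ_map_ι (T : w.TruncationPair k (k + 1) X)
    (T' : w.TruncationPair k (k + 1) Y) {φ : X ⟶ Y} {κ : T.lower.left ⟶ T'.upper.left}
    (hκ : κ ≫ T'.upper.ι = T.lower.ι ≫ φ) :
    virtualTruncationπ H T' ≫ virtualTruncationMap H T T' φ ≫ virtualTruncationι H T =
      H.map κ.op := by
  have hκ' : T.lower.lift T'.lower le_rfl φ ≫ T'.conn = κ :=
    T'.upper.eq_of_comp_ι T.lower.left_le (lt_add_one k)
      (by rw [Category.assoc, T'.conn_ι, Decomposition.lift_ι, hκ])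
  rw [virtualTruncationMap_ι H T T' (T.lower.lift_ι T'.lower le_rfl φ), ← Category.assoc,
    virtualTruncationπ_ι, ← H.map_comp, ← op_comp, hκ']

/-- The virtual `t`-truncation `τ_{≤k}(H)` as a functor, for given choices of the truncations of
all objects. -/
noncomputable def virtualTruncationFunctor (T : ∀ X : C, w.TruncationPair k (k + 1) X) :
    Cᵒᵖ ⥤ A where
  obj X := virtualTruncation H (T X.unop)
  map φ := virtualTruncationMap H (T _) (T _) φ.unop
  map_id X := by
    rw [← cancel_mono (virtualTruncationι H _),
      virtualTruncationMap_ι H _ _ (a := 𝟙 _) (by simp), op_id, H.map_id, Category.comp_id,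
      Category.id_comp]
  map_comp {X Y Z} φ ψ := by
    let a := (T Y.unop).lower.lift (T X.unop).lower le_rfl φ.unop
    let b := (T Z.unop).lower.lift (T Y.unop).lower le_rfl ψ.unop
    have hba : (b ≫ a) ≫ (T X.unop).lower.ι = (T Z.unop).lower.ι ≫ (φ ≫ ψ).unop := by
      rw [Category.assoc, Decomposition.lift_ι, ← Category.assoc, Decomposition.lift_ι,
        Category.assoc, unop_comp]
    rw [← cancel_mono (virtualTruncationι H _), virtualTruncationMap_ι H _ _ hba, Category.assoc,
      virtualTruncationMap_ι H _ _ (Decomposition.lift_ι _ _ le_rfl ψ.unop), ← Category.assoc,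
      virtualTruncationMap_ι H _ _ (Decomposition.lift_ι _ _ le_rfl φ.unop), Category.assoc,
      op_comp, H.map_comp]

instance [H.PreservesZeroMorphisms] (T : ∀ X : C, w.TruncationPair k (k + 1) X) :
    (virtualTruncationFunctor H T).PreservesZeroMorphisms where
  map_zero X Y := by
    change virtualTruncationMap H _ _ 0 = 0
    rw [← cancel_mono (virtualTruncationι H _),
      virtualTruncationMap_ι H _ _ (a := 0) (by rw [zero_comp, comp_zero]), op_zero, H.map_zero,
      zero_comp, comp_zero]

lemma exists_cocone_comp_conn_eq {S : Triangle C} (hS : S ∈ distTriang C)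
    (T₁ : w.TruncationPair k (k + 1) S.obj₁) (T₂ : w.TruncationPair k (k + 1) S.obj₂)
    (D : w.Decomposition (k + 1) S.obj₃) {κ : T₂.lower.left ⟶ D.left}
    (hκ : κ ≫ D.ι = T₂.lower.ι ≫ S.mor₂) :
    ∃ (Q : C) (q : Q ⟶ T₂.lower.left) (δ : D.left ⟶ Q⟦(1 : ℤ)⟧) (a : Q ⟶ T₁.lower.left),
      Triangle.mk q κ δ ∈ distTriang C ∧
        q ≫ T₂.conn = a ≫ T₁.lower.lift T₂.lower le_rfl S.mor₁ ≫ T₂.conn := by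
  obtain ⟨Q, q, δ, hQ⟩ := distinguished_cocone_triangle₁ κ
  have hqκ : q ≫ κ = 0 := comp_distTriang_mor_zero₁₂ _ hQ
  have hQk : w.le k Q := le_obj₁_of_distinguished _ hQ T₂.lower.left_le D.left_le
  obtain ⟨b, hb⟩ : ∃ b : Q ⟶ S.obj₁, q ≫ T₂.lower.ι = b ≫ S.mor₁ :=
    S.coyoneda_exact₂ hS _ (by rw [Category.assoc, ← hκ, ← Category.assoc, hqκ, zero_comp])
  obtain ⟨a, ha⟩ := T₁.lower.exists_comp_ι_eq_of_le hQk b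
  refine ⟨Q, q, δ, a, hQ, ?_⟩
  rw [← Category.assoc]
  refine T₂.comp_conn_eq (lt_add_one k) hQk ?_
  rw [hb, Category.assoc, Decomposition.lift_ι, ← Category.assoc, ha]

lemma virtualTruncationMap_exact_up_to_refinements [H.IsHomological] {S : Triangle C}
    (hS : S ∈ distTriang C) (T₁ : w.TruncationPair k (k + 1) S.obj₁)
    (T₂ : w.TruncationPair k (k + 1) S.obj₂) (T₃ : w.TruncationPair k (k + 1) S.obj₃) {W : A}
    (x : W ⟶ virtualTruncation H T₂) (hx : x ≫ virtualTruncationMap H T₁ T₂ S.mor₁ = 0) :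
    ∃ (W' : A) (p : W' ⟶ W) (_ : Epi p) (x' : W' ⟶ virtualTruncation H T₃),
      p ≫ x = x' ≫ virtualTruncationMap H T₂ T₃ S.mor₂ := by
  let c := T₁.lower.lift T₂.lower le_rfl S.mor₁
  have hκ := T₂.lower.lift_ι T₃.upper (by lia) S.mor₂
  obtain ⟨Q, q, δ, a, hQ, hqa⟩ := exists_cocone_comp_conn_eq hS T₁ T₂ T₃.upper hκ
  obtain ⟨W₁, p, _, y, hy⟩ := surjective_up_to_refinements_of_epi (virtualTruncationπ H T₂) x
  have hpx : p ≫ x ≫ virtualTruncationι H T₂ = y ≫ H.map T₂.conn.op := by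
    rw [← Category.assoc, hy, Category.assoc, virtualTruncationπ_ι]
  have hxc : x ≫ virtualTruncationι H T₂ ≫ H.map c.op = 0 := by
    rw [← virtualTruncationMap_ι H T₁ T₂ (Decomposition.lift_ι _ _ _ _), reassoc_of% hx, zero_comp]
  have hq : (p ≫ x ≫ virtualTruncationι H T₂) ≫ H.map q.op = 0 := by
    calc (p ≫ x ≫ virtualTruncationι H T₂) ≫ H.map q.op
      _ = y ≫ H.map (q ≫ T₂.conn).op := by rw [hpx, Category.assoc, ← H.map_comp, op_comp]
      _ = (y ≫ H.map T₂.conn.op) ≫ H.map c.op ≫ H.map a.op := by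
        simp only [hqa, op_comp, H.map_comp, Category.assoc, c]
      _ = p ≫ (x ≫ virtualTruncationι H T₂ ≫ H.map c.op) ≫ H.map a.op := by
        simp only [← hpx, Category.assoc]
      _ = 0 := by rw [hxc, zero_comp, comp_zero]
  obtain ⟨W₂, p', _, z, hz⟩ : ∃ (W₂ : A) (p' : W₂ ⟶ W₁) (_ : Epi p')
      (z : W₂ ⟶ H.obj (op T₃.upper.left)), p' ≫ p ≫ x ≫ virtualTruncationι H T₂ =
        z ≫ H.map (T₂.lower.lift T₃.upper (by lia) S.mor₂).op :=
    (H.map_distinguished_op_exact _ hQ).exact_up_to_refinements _ hq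
  refine ⟨W₂, p' ≫ p, inferInstance, z ≫ virtualTruncationπ H T₃, ?_⟩
  rw [← cancel_mono (virtualTruncationι H T₂)]
  simp only [Category.assoc, virtualTruncationπ_map_ι H T₂ T₃ hκ, hz]

instance [H.IsHomological] (T : ∀ X : C, w.TruncationPair k (k + 1) X) :
    (virtualTruncationFunctor H T).IsHomological where
  exact S hS := by
    rw [ShortComplex.exact_iff_exact_up_to_refinements]
    intro W x hx
    exact virtualTruncationMap_exact_up_to_refinements H (unop_distinguished S hS) _ _ _ x hx

variable {H}

lemma isZero_virtualTruncation_iff {T : w.TruncationPair k (k + 1) X} :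
    IsZero (virtualTruncation H T) ↔ H.map T.conn.op = 0 := by
  constructor
  · intro h
    rw [← virtualTruncationπ_ι, h.eq_of_tgt (virtualTruncationπ H T) 0, zero_comp]
  · intro h
    exact (isZero_zero A).of_iso (imageZero' h)

lemma IsWithoutWeights.isZero_virtualTruncation (hmn : m ≤ n + 1)
    (hM : w.IsWithoutWeights m n M) (hH : ∀ X, w.le (m - 1) X → IsZero (H.obj (op X)))
    (T : w.TruncationPair n (n + 1) M) : IsZero (virtualTruncation H T) := by
  obtain ⟨D, E, h, hh⟩ := hM
  let a := T.lower.lift D le_rfl (𝟙 M)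
  let b := E.lift T.upper (by lia) (𝟙 M)
  have hconn : T.conn = a ≫ h ≫ b :=
    T.upper.eq_of_comp_ι T.lower.left_le (lt_add_one n) (by
      simp only [a, b, Category.assoc, Decomposition.lift_ι, Category.comp_id, hh, T.conn_ι])
  rw [isZero_virtualTruncation_iff, hconn, op_comp, op_comp, H.map_comp, H.map_comp,
    (hH _ E.left_le).eq_of_tgt (H.map b.op) 0, zero_comp, zero_comp]

lemma virtualTruncationFunctor_isOfWeightRange [H.IsHomological] (hmn : m ≤ n + 1)
    (hH : ∀ X, w.le (m - 1) X → IsZero (H.obj (op X)))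
    (T : ∀ X : C, w.TruncationPair n (n + 1) X) :
    w.IsOfWeightRange m n (virtualTruncationFunctor H T) where
  cohomological := inferInstance
  isZero_of_le X hX := (isWithoutWeights_of_le hX).isZero_virtualTruncation hmn hH (T X)
  isZero_of_ge X hX := (isWithoutWeights_of_ge hX).isZero_virtualTruncation hmn hH (T X)

end VirtualTruncation
lemma IsWithoutWeights.exists_retract (hM : w.IsWithoutWeights m n M) :
    ∃ (M' A B : C), Nonempty (Retract M M') ∧ IsExtensionOf M' B A ∧
      w.ge (n + 1) B ∧ w.le (m - 1) A := by
  obtain ⟨D, E, h, hh⟩ := hM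
  rw [Category.comp_id] at hh
  obtain ⟨M', hr, hM'⟩ := exists_retract_isExtensionOf D.distinguished hh
  exact ⟨M', E.left, D.right, hr, hM', D.right_ge, E.left_le⟩

lemma IsOfWeightRange.isZero_of_isExtensionOf {A : Type*} [Category* A] [Abelian A]
    {H : Cᵒᵖ ⥤ A} (hH : w.IsOfWeightRange m n H) {L R : C} (hM : IsExtensionOf M R L)
    (hR : w.ge (n + 1) R) (hL : w.le (m - 1) L) : IsZero (H.obj (op M)) := by
  have := hH.cohomological
  obtain ⟨f, g, h, hT⟩ := hM
  exact (H.map_distinguished_op_exact _ hT).isZero_of_both_zeros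
    ((hH.isZero_of_ge R hR).eq_of_src _ _) ((hH.isZero_of_le L hL).eq_of_tgt _ _)

lemma isZero_preadditiveYoneda_obj (hkl : k < l) (hX : w.le k X) {I : C} (hI : w.ge l I) :
    IsZero ((preadditiveYoneda.obj I).obj (op X)) := by
  rw [AddCommGrpCat.isZero_iff_subsingleton]
  exact ⟨fun f g ↦ (zero_of_le_of_ge hkl hX hI f).trans (zero_of_le_of_ge hkl hX hI g).symm⟩

lemma exists_isZero_virtualTruncation_preadditiveYoneda (hmn : m ≤ n + 1)
    (h : ∀ (A : Type (max (v + 1) uA)) [Category.{max v vA} A] [Abelian A] (H : Cᵒᵖ ⥤ A),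
      w.IsOfWeightRange m n H → IsZero (H.obj (op M))) {I : C} (hI : w.ge m I) :
    ∃ T : w.TruncationPair n (n + 1) M,
      IsZero (virtualTruncation (preadditiveYoneda.obj I) T) := by
  obtain ⟨B, _, _, ⟨e⟩⟩ := exists_abelian_equivalence_ulift.{v + 1, v, uA, vA} AddCommGrpCat.{v}
  let H := preadditiveYoneda.obj I ⋙ e.functor
  have : H.IsHomological := isHomological_comp _ _
  let T (X : C) : w.TruncationPair n (n + 1) X := (w.exists_truncationPair (by lia) X).some
  have hH (X : C) (hX : w.le (m - 1) X) : IsZero (H.obj (op X)) :=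
    e.functor.map_isZero (isZero_preadditiveYoneda_obj (by lia) hX hI)
  have hT : IsZero (virtualTruncation H (T M)) :=
    h B _ (virtualTruncationFunctor_isOfWeightRange hmn hH T)
  rw [isZero_virtualTruncation_iff] at hT
  exact ⟨T M, isZero_virtualTruncation_iff.2 (e.functor.zero_of_map_zero _ hT)⟩

lemma isWithoutWeights_of_isZero_virtualTruncation (D : w.Decomposition (m - 1) M)
    (T : w.TruncationPair n (n + 1) M)
    (h : IsZero (virtualTruncation (preadditiveYoneda.obj D.right) T)) :
    w.IsWithoutWeights m n M := by
  rw [isZero_virtualTruncation_iff] at h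
  have hT (f : T.upper.left ⟶ D.right) : T.conn ≫ f = 0 := ConcreteCategory.congr_hom h f
  refine .of_comp_eq_zero T.lower D ?_
  rw [Category.id_comp, ← T.conn_ι, Category.assoc, hT]

lemma IsWithoutWeights.exists_isExtensionOf [IsIdempotentComplete C] (hmn : m ≤ n)
    (hM : w.IsWithoutWeights m n M) :
    ∃ (A B : C), IsExtensionOf M B A ∧ w.ge (n + 1) B ∧ w.le (m - 1) A := by
  obtain ⟨D, E, h, hh⟩ := hM
  rw [Category.comp_id] at hh
  let c := E.lift D (by lia) (𝟙 M)
  have hc : c ≫ D.ι = E.ι := by rw [Decomposition.lift_ι, Category.comp_id]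
  have hchc : c ≫ h ≫ c = c := D.eq_of_comp_ι E.left_le (by lia) (by simp [hc, hh])
  obtain ⟨P, i, p, hip, hpi⟩ := IsIdempotentComplete.idempotents_split E.left (c ≫ h)
    (by simpa using hchc =≫ h)
  -- The triangle on `P ⟶ M` is a retract of the `n`-decomposition `D`.
  obtain ⟨B, g, δ, hT⟩ := distinguished_cocone_triangle (i ≫ E.ι)
  let r : RetractArrow (i ≫ E.ι) D.ι := {
    i := Arrow.homMk (i ≫ c) (𝟙 M) (by simp [hc])
    r := Arrow.homMk (h ≫ p) (𝟙 M) (by simp [reassoc_of% hpi, hh, hc])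
    retract := by
      ext
      · simp [← reassoc_of% hpi, hip]
      · simp }
  obtain ⟨hB⟩ := nonempty_retract_obj₃ hT D.distinguished r
  exact ⟨P, B, ⟨_, g, δ, hT⟩, (w.ge (n + 1)).prop_of_retract hB D.right_ge,
    (w.le (m - 1)).prop_of_retract ⟨i, p, hip⟩ E.left_le⟩

lemma exists_truncationPair_isIso_of_isExtensionOf {A B : C} (hM : IsExtensionOf M B A)
    (hB : w.ge (n + 1) B) (hA : w.le (m - 1) A) (hk : m - 1 ≤ k) (hkl : k ≤ l)
    (hl : l ≤ n) : ∃ T : w.TruncationPair k l M, IsIso T.conn := by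
  obtain ⟨f, g, h, hT⟩ := hM
  exact ⟨
    { lower := ⟨A, B, f, g, h, hT, le_mono hk _ hA, ge_anti (by lia) _ hB⟩
      upper := ⟨A, B, f, g, h, hT, le_mono (by lia) _ hA, ge_anti (by lia) _ hB⟩
      conn := 𝟙 A
      conn_ι := Category.id_comp f }, (inferInstance : IsIso (𝟙 A))⟩

lemma exists_isExtensionOf_of_iso (D : w.Decomposition (m - 1) M) (E : w.Decomposition n M)
    (e : D.left ≅ E.left) :
    ∃ (A B : C), IsExtensionOf M B A ∧ w.ge (n + 1) B ∧ w.le (m - 1) A :=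
  ⟨E.left, E.right, ⟨E.ι, E.π, E.δ, E.distinguished⟩, E.right_ge,
    (w.le (m - 1)).prop_of_iso e D.left_le⟩

lemma TruncationPair.isWithoutWeights (T : w.TruncationPair (m - 1) n M) [IsIso T.conn] :
    w.IsWithoutWeights m n M :=
  ⟨T.upper, T.lower, inv T.conn, by rw [IsIso.inv_comp_eq, Category.comp_id, T.conn_ι]⟩

end WeightStructure

end

theorem theorem2p4_general {C : Type u} [Category.{v} C] [Preadditive C]
    [HasZeroObject C] [HasShift C ℤ] [∀ k : ℤ, (shiftFunctor C k).Additive] [Pretriangulated C]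
    (w : WeightStructure C) (m n : ℤ) (hmn : m ≤ n) (M : C) :
    List.TFAE [
      w.IsWithoutWeights m n M,
      ∃ (M' A B : C), Nonempty (Retract M M') ∧ IsExtensionOf M' B A ∧
        w.ge (n + 1) B ∧ w.le (m - 1) A,
      ∀ (A : Type (max (v + 1) uA)) [Category.{max v vA} A] [Abelian A] (H : Cᵒᵖ ⥤ A),
        w.IsOfWeightRange m n H → IsZero (H.obj (op M)),
      ∀ I : C, w.ge m I → ∀ T : w.TruncationPair n (n + 1) M,
        IsZero (WeightStructure.virtualTruncation (preadditiveYoneda.obj I) T),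
      ∀ I : C, w.ge m I → ∃ T : w.TruncationPair n (n + 1) M,
        IsZero (WeightStructure.virtualTruncation (preadditiveYoneda.obj I) T),
      ∀ (D : w.Decomposition (m - 1) M) (T : w.TruncationPair n (n + 1) M),
        IsZero (WeightStructure.virtualTruncation (preadditiveYoneda.obj D.right) T),
      ∃ (D : w.Decomposition (m - 1) M) (T : w.TruncationPair n (n + 1) M),
        IsZero (WeightStructure.virtualTruncation (preadditiveYoneda.obj D.right) T)] ∧
    (IsIdempotentComplete C → List.TFAE [
      w.IsWithoutWeights m n M,
      ∃ (A B : C), IsExtensionOf M B A ∧ w.ge (n + 1) B ∧ w.le (m - 1) A,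
      ∃ (D : w.Decomposition (m - 1) M) (E : w.Decomposition n M), Nonempty (D.left ≅ E.left),
      ∃ T : w.TruncationPair (m - 1) n M, IsIso T.conn]) := by
  constructor
  · tfae_have 1 → 2 := fun hM ↦ hM.exists_retract
    tfae_have 2 → 3 := fun ⟨_, _, _, ⟨r⟩, hM', hB, hA⟩ _ _ _ H hH ↦
      .of_mono (r.op.map H).i (hH.isZero_of_isExtensionOf hM' hB hA)
    tfae_have 3 → 5 := fun h I hI ↦
      WeightStructure.exists_isZero_virtualTruncation_preadditiveYoneda.{u, v, uA, vA}
        (by lia) h hI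
    tfae_have 5 → 7 := fun h ↦
      have ⟨D⟩ := w.exists_decomposition (m - 1) M
      ⟨D, h D.right D.right_ge_pred⟩
    tfae_have 7 → 1 := fun ⟨D, T, h⟩ ↦
      WeightStructure.isWithoutWeights_of_isZero_virtualTruncation D T h
    tfae_have 1 → 4 := fun hM I hI ↦ hM.isZero_virtualTruncation (by lia) fun X hX ↦
      WeightStructure.isZero_preadditiveYoneda_obj (by lia) hX hI
    tfae_have 4 → 6 := fun h D ↦ h D.right D.right_ge_pred
    tfae_have 6 → 7 := fun h ↦
      have ⟨D⟩ := w.exists_decomposition (m - 1) M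
      have ⟨T⟩ := w.exists_truncationPair (by lia) M
      ⟨D, T, h D T⟩
    tfae_finish
  · intro _
    tfae_have 1 → 2 := fun hM ↦ hM.exists_isExtensionOf hmn
    tfae_have 2 → 4 := fun ⟨_, _, hM, hB, hA⟩ ↦
      WeightStructure.exists_truncationPair_isIso_of_isExtensionOf hM hB hA le_rfl (by lia) le_rfl
    tfae_have 4 → 3 := fun ⟨T, _⟩ ↦ ⟨T.lower, T.upper, ⟨asIso T.conn⟩⟩
    tfae_have 3 → 2 := fun ⟨D, E, ⟨e⟩⟩ ↦ WeightStructure.exists_isExtensionOf_of_iso D E e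
    tfae_have 4 → 1 := fun ⟨T, _⟩ ↦ T.isWithoutWeights
    tfae_finish

theorem theorem2p4 {C : Type u} [Category.{v} C] [Preadditive C] [HasZeroObject C]
    [HasShift C ℤ] [∀ k : ℤ, (shiftFunctor C k).Additive] [Pretriangulated C] [IsTriangulated C]
    (w : WeightStructure C) (m n : ℤ) (hmn : m ≤ n) (M : C) :
    -- Part I
    List.TFAE [
      w.IsWithoutWeights m n M,
      ∃ (M' A B : C), Nonempty (Retract M M') ∧ IsExtensionOf M' B A ∧
        w.ge (n + 1) B ∧ w.le (m - 1) A,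
      ∀ (A : Type (max (v + 1) uA)) [Category.{max v vA} A] [Abelian A] (H : Cᵒᵖ ⥤ A),
        w.IsOfWeightRange m n H → IsZero (H.obj (op M)),
      -- vanishing of `τ_{≤n}(H_I)(M)` for all `I`, for all (resp. some) choices of truncations
      ∀ I : C, w.ge m I → ∀ T : w.TruncationPair n (n + 1) M,
        IsZero (WeightStructure.virtualTruncation (preadditiveYoneda.obj I) T),
      ∀ I : C, w.ge m I → ∃ T : w.TruncationPair n (n + 1) M,
        IsZero (WeightStructure.virtualTruncation (preadditiveYoneda.obj I) T),
      -- the same for `I₀ = w_{≥m} M`, for all (resp. some) choices of it and of truncations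
      ∀ (D : w.Decomposition (m - 1) M) (T : w.TruncationPair n (n + 1) M),
        IsZero (WeightStructure.virtualTruncation (preadditiveYoneda.obj D.right) T),
      ∃ (D : w.Decomposition (m - 1) M) (T : w.TruncationPair n (n + 1) M),
        IsZero (WeightStructure.virtualTruncation (preadditiveYoneda.obj D.right) T)] ∧
    -- Part II
    (IsIdempotentComplete C → List.TFAE [
      w.IsWithoutWeights m n M,
      ∃ (A B : C), IsExtensionOf M B A ∧ w.ge (n + 1) B ∧ w.le (m - 1) A,
      ∃ (D : w.Decomposition (m - 1) M) (E : w.Decomposition n M), Nonempty (D.left ≅ E.left),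
      ∃ T : w.TruncationPair (m - 1) n M, IsIso T.conn]) :=
  theorem2p4_general.{u, v, uA, vA} w m n hmn M
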